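/- Let $\mathcal C$ be a simplicial model category in the sense of Quillen (a model category that is enriched in simplicial sets, is tensored and cotensored over finite simplicial sets, and satisfies: for every cofibration $i\colon A\to B$ and every fibration $p\colon E\to F$ the map $\operatorname{map}(B,E)\to\operatorname{map}(A,E)\times_{\operatorname{map}(A,F)}\operatorname{map}(B,F)$ is a Kan fibration, which is trivial if $i$ or $p$ is a weak equivalence). For objects $a\colon A\to S$ and $b\colon B\to S$ over $S$, let $\operatorname{map}_{\mathcal C/S}(A,B)$ be the fibre of $b_*\colon\operatorname{map}(A,B)\to\operatorname{map}(A,S)$ over the vertex $a$; if $B$ is an abelian group object of $\mathcal C/S$, this is a simplicial abelian group. Let $\vartheta\colon U\to V$ be a fixed map in $\mathcal C$, and let $\varphi\colon X\to Y$ and $\psi\colon W\to Z$ be objects of $\mathcal C(\to)/\vartheta$, that is, there are maps $x\colon X\to U$, $y\colon Y\to V$, $w\colon W\to U$, $z\colon Z\to V$ with $y\varphi=\vartheta x$ and $z\psi=\vartheta w$. View $X$ as an object over $V$ through $\vartheta x$. Let $\operatorname{map}_{\mathcal C(\to)/\vartheta}(\varphi,\psi)$ be the simplicial set of pairs $(f,g)$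 of simplices of $\operatorname{map}_{\mathcal C/U}(X,W)$ and $\operatorname{map}_{\mathcal C/V}(Y,Z)$ with $\psi\circ f=g\circ\varphi$. Suppose that $\varphi$ is a cofibration with cofibrant source $X$, that $z\colon Z\to V$ is a fibration, and that $W$ and $Z$ are given abelian group structures in $\mathcal C/U$ and $\mathcal C/V$ respectively. Then $$\operatorname{map}_{\mathcal C(\to)/\vartheta}(\varphi,\psi)\longrightarrow\operatorname{map}_{\mathcal C/U}(X,W)\times\operatorname{map}_{\mathcal C/V}(Y,Z)\xrightarrow{\ \xi\ }\operatorname{map}_{\mathcal C/V}(X,Z),\qquad \xi(f,g)=\psi\circ f-g\circ\varphi,$$ is a fibration sequence of simplicial sets: $\xi$ is a Kan fibration between Kan complexes, and the first map is the inclusion of its fibre over $0$. If moreover $\psi$ is a homomorphism of group objects over $\vartheta$, then this is a sequence of simplicial abelian groups: $\xi$ is a homomorphism, and $\operatorname{map}_{\mathcal C(\to)/\vartheta}(\varphi,\psi)$ has the structure of a simplicial abelian group for which the first map is a homomorphism. -/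

import Mathlib

open CategoryTheory Category Limits MonoidalCategory CartesianMonoidalCategory HomotopicalAlgebra
  Opposite Simplicial
open scoped MonObj SSet.modelCategoryQuillen

universe v u

attribute [local instance] Over.cartesianMonoidalCategory Over.braidedCategory

namespace SimplicialMapping

noncomputable section

section Tensors

variable {C : Type u} [Category.{v} C] [SimplicialCategory C]

/-- `t : K ⟶ map(X, T)` exhibits `T` as the tensor `X ⊗ K`: for every `Y`, the induced morphism
from `map(T, Y)` to the internal hom `map(X, Y) ^ K` is an isomorphism of simplicial sets. -/
def IsTensor {K : SSet.{v}} {X T : C} (t : K ⟶ SimplicialCategory.sHom X T) : Prop :=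
  ∀ Y : C, IsIso (MonoidalClosed.curry
    (t ▷ SimplicialCategory.sHom T Y ≫ SimplicialCategory.sHomComp X T Y))

/-- `t : K ⟶ map(P, Y)` exhibits `P` as the cotensor `Y ^ K`: for every `X`, the induced morphism
from `map(X, P)` to the internal hom `map(X, Y) ^ K` is an isomorphism of simplicial sets. -/
def IsCotensor {K : SSet.{v}} {P Y : C} (t : K ⟶ SimplicialCategory.sHom P Y) : Prop :=
  ∀ X : C, IsIso (MonoidalClosed.curry
    ((β_ K (SimplicialCategory.sHom X P)).hom ≫ SimplicialCategory.sHom X P ◁ t ≫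
      SimplicialCategory.sHomComp X P Y))

end Tensors

/-- Quillen's simplicial model categories: a model category which is a simplicial category,
has tensors and cotensors by finite simplicial sets, and such that for every cofibration
`i : A ⟶ B` and every fibration `p : X ⟶ Y` the morphism
`map(B, X) ⟶ map(A, X) ×_{map(A, Y)} map(B, Y)` (this is `sq.π` below) is a Kan fibration, which is
trivial (has the right lifting property with respect to all `∂Δ[n] ⟶ Δ[n]`)
if `i` or `p` is a weak equivalence. -/
class IsSimplicialModelCategory (C : Type u) [Category.{v} C] [ModelCategory C]
    [SimplicialCategory C] : Prop where
  exists_isTensor (K : SSet.{v}) [K.Finite] (X : C) :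
    ∃ (T : C) (t : K ⟶ SimplicialCategory.sHom X T), IsTensor t
  exists_isCotensor (K : SSet.{v}) [K.Finite] (Y : C) :
    ∃ (P : C) (t : K ⟶ SimplicialCategory.sHom P Y), IsCotensor t
  fibration_π {A B X Y : C} (i : A ⟶ B) (p : X ⟶ Y) [Cofibration i] [Fibration p]
    (sq : (SimplicialCategory.sHomFunctor C).PullbackObjObj i p) : Fibration sq.π
  trivialFibration_π {A B X Y : C} (i : A ⟶ B) (p : X ⟶ Y) [Cofibration i] [Fibration p]
    (h : WeakEquivalence i ∨ WeakEquivalence p)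
    (sq : (SimplicialCategory.sHomFunctor C).PullbackObjObj i p) :
    SSet.modelCategoryQuillen.I.rlp sq.π

section MappingSpaces

variable {C : Type u} [Category.{v} C] [SimplicialCategory C]

/-- The map `map(X, Y) ⟶ map(X, Y')` of composition with `g : Y ⟶ Y'`. -/
abbrev postcomp (X : C) {Y Y' : C} (g : Y ⟶ Y') :
    SimplicialCategory.sHom X Y ⟶ SimplicialCategory.sHom X Y' :=
  eHomWhiskerLeft SSet.{v} X g

/-- The map `map(X', Y) ⟶ map(X, Y)` of composition with `f : X ⟶ X'`. -/
abbrev precomp {X X' : C} (f : X ⟶ X') (Y : C) :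
    SimplicialCategory.sHom X' Y ⟶ SimplicialCategory.sHom X Y :=
  eHomWhiskerRight SSet.{v} f Y

/-- The constant map of a simplicial set `K` to the vertex `f` of `map(X, Y)`. -/
def constMap (K : SSet.{v}) {X Y : C} (f : X ⟶ Y) : K ⟶ SimplicialCategory.sHom X Y :=
  toUnit K ≫ eHomEquiv SSet.{v} f

lemma comp_constMap {K L : SSet.{v}} (k : K ⟶ L) {X Y : C} (f : X ⟶ Y) :
    k ≫ constMap L f = constMap K f := by
  simp [constMap]

lemma constMap_postcomp (K : SSet.{v}) {X Y Z : C} (f : X ⟶ Y) (g : Y ⟶ Z) :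
    constMap K f ≫ postcomp X g = constMap K (f ≫ g) := by
  simp [constMap, postcomp, eHomWhiskerLeft, eHomEquiv_comp, MonoidalCategory.tensorHom_def,
    unitors_inv_equal]

lemma constMap_precomp (K : SSet.{v}) {X Y Z : C} (f : X ⟶ Y) (g : Y ⟶ Z) :
    constMap K g ≫ precomp f Z = constMap K (f ≫ g) := by
  simp [constMap, precomp, eHomWhiskerRight, eHomEquiv_comp, MonoidalCategory.tensorHom_def']

/-- The mapping space `map_{C/S}(A, B)` of two objects `a : A ⟶ S` and `b : B ⟶ S` over `S`: the
fibre of composition with `b`, `map(A, B) ⟶ map(A, S)`, over the vertex `a`. -/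
def overMap {S A B : C} (a : A ⟶ S) (b : B ⟶ S) : (SimplicialCategory.sHom A B).Subcomplex where
  obj n := {σ | (postcomp A b).app n σ = (constMap (SimplicialCategory.sHom A B) a).app n σ}
  map {n m} f σ hσ := by
    simp only [Set.mem_preimage, Set.mem_ofPred_eq, NatTrans.naturality_apply] at hσ ⊢
    rw [hσ]

lemma le_overMap {S A B : C} (a : A ⟶ S) (b : B ⟶ S) {K : SSet.{v}}
    (k : K ⟶ SimplicialCategory.sHom A B) (hk : k ≫ postcomp A b = constMap K a) :
    SSet.Subcomplex.range k ≤ overMap a b := by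
  rintro n _ ⟨σ, rfl⟩
  have h := hk.trans (comp_constMap k a).symm
  exact ConcreteCategory.congr_hom (NatTrans.congr_app h n) σ

lemma overMap_ι_postcomp {S A B : C} (a : A ⟶ S) (b : B ⟶ S) :
    (overMap a b).ι ≫ postcomp A b = constMap _ a := by
  rw [← comp_constMap (overMap a b).ι a]
  ext n σ
  exact σ.2

/-- Composition with `g : B ⟶ B'` over `s : S ⟶ S'`, as a map
`map_{C/S}(A, B) ⟶ map_{C/S'}(A, B')`. -/
def overPostcomp {S S' A B B' : C} (a : A ⟶ S) (b : B ⟶ S) (a' : A ⟶ S') (b' : B' ⟶ S')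
    (s : S ⟶ S') (g : B ⟶ B') (ha : a ≫ s = a') (hg : g ≫ b' = b ≫ s) :
    (overMap a b : SSet.{v}) ⟶ overMap a' b' :=
  SSet.Subcomplex.lift ((overMap a b).ι ≫ postcomp A g) (le_overMap _ _ _ (by
    rw [assoc, ← eHomWhiskerLeft_comp, hg, eHomWhiskerLeft_comp, ← assoc, overMap_ι_postcomp,
      constMap_postcomp, ha]))

/-- Composition with `f : A ⟶ A'` over `S`, as a map `map_{C/S}(A', B) ⟶ map_{C/S}(A, B)`. -/
def overPrecomp {S A A' B : C} (a : A ⟶ S) (a' : A' ⟶ S) (b : B ⟶ S)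
    (f : A ⟶ A') (hf : f ≫ a' = a) :
    (overMap a' b : SSet.{v}) ⟶ overMap a b :=
  SSet.Subcomplex.lift ((overMap a' b).ι ≫ precomp f B) (le_overMap _ _ _ (by
    rw [assoc, ← eHom_whisker_exchange, ← assoc, overMap_ι_postcomp, constMap_precomp, hf]))

/-- The functor `C/S ⥤ SSet`, `B ↦ map_{C/S}(A, B)`. -/
def overMapFunctor {S A : C} (a : A ⟶ S) : Over S ⥤ SSet.{v} where
  obj B := overMap a B.hom
  map {B B'} g := overPostcomp a B.hom a B'.hom (𝟙 S) g.left (by simp) (by simp)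
  map_id B := by
    rw [← cancel_mono (overMap a B.hom).ι]
    simp [overPostcomp]
  map_comp {B B' B''} f g := by
    rw [← cancel_mono (overMap a B''.hom).ι]
    simp [overPostcomp]

end MappingSpaces

section Limits

variable {C : Type u} [Category.{v} C] [SimplicialCategory C]

/-- If `T` is a tensor `X ⊗ Δ[n]`, then the `n`-simplices of `map(X, Y)` are the morphisms
`T ⟶ Y`. -/
lemma IsTensor.bijective {n : SimplexCategory} {X T : C}
    {t : SSet.stdSimplex.obj n ⟶ SimplicialCategory.sHom X T} (ht : IsTensor t) (Y : C) :
    Function.Bijective (fun f : T ⟶ Y ↦ (postcomp X f).app (op n) (SSet.yonedaEquiv t)) := by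
  have := ht Y
  let e : (T ⟶ Y) ≃ (SimplicialCategory.sHom X Y).obj (op n) :=
    (eHomEquiv SSet.{v}).trans <| (asIso (MonoidalClosed.curry
      (t ▷ SimplicialCategory.sHom T Y ≫ SimplicialCategory.sHomComp X T Y))).homToEquiv.trans <|
      ((ihom.adjunction (SSet.stdSimplex.obj n)).homEquiv (𝟙_ SSet.{v}) _).symm.trans <|
      ((ρ_ (SSet.stdSimplex.obj n)).homFromEquiv).trans SSet.yonedaEquiv
  have he (f : T ⟶ Y) : e f = (postcomp X f).app (op n) (SSet.yonedaEquiv t) := by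
    have h1 : e f = SSet.yonedaEquiv ((ρ_ _).inv ≫ MonoidalClosed.uncurry (eHomEquiv SSet.{v} f ≫
        MonoidalClosed.curry (t ▷ SimplicialCategory.sHom T Y ≫
          SimplicialCategory.sHomComp X T Y))) := rfl
    have h2 : (ρ_ _).inv ≫ MonoidalClosed.uncurry (eHomEquiv SSet.{v} f ≫
        MonoidalClosed.curry (t ▷ SimplicialCategory.sHom T Y ≫
          SimplicialCategory.sHomComp X T Y)) = t ≫ postcomp X f := by
      rw [MonoidalClosed.uncurry_natural_left, MonoidalClosed.uncurry_curry, postcomp,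
        eHomWhiskerLeft, rightUnitor_inv_naturality_assoc, whisker_exchange_assoc]
    rw [h1, h2]
    rfl
  rw [← show ⇑e = _ from funext he]
  exact e.bijective

/-- Simplices of `map_{C/S}(A, B)` are morphisms over `S` from a tensor of `A`. -/
lemma exists_bijective_overMap [ModelCategory C] [IsSimplicialModelCategory C] {S A : C}
    (a : A ⟶ S) (n : SimplexCategory) :
    ∃ (T : Over S) (t : ((overMapFunctor a).obj T).obj (op n)), ∀ B : Over S,
      Function.Bijective (fun f : T ⟶ B ↦ ((overMapFunctor a).map f).app (op n) t) := by
  obtain ⟨T, t, ht⟩ := IsSimplicialModelCategory.exists_isTensor (SSet.stdSimplex.obj n) A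
  obtain ⟨p, hp⟩ := (ht.bijective S).2 ((constMap (SSet.stdSimplex.obj n) a).app (op n)
    (SSet.yonedaEquiv (𝟙 _)))
  have hc : (constMap (SSet.stdSimplex.obj n) a).app (op n) (SSet.yonedaEquiv (𝟙 _)) =
      (constMap (SimplicialCategory.sHom A T) a).app (op n) (SSet.yonedaEquiv t) := by
    rw [← comp_constMap t a]
    rfl
  refine ⟨Over.mk p, ⟨SSet.yonedaEquiv t, hp.trans hc⟩, fun B ↦ ⟨fun f g hfg ↦ ?_, fun σ ↦ ?_⟩⟩
  · ext
    exact (ht.bijective B.left).1 (congrArg Subtype.val hfg)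
  · obtain ⟨g, hg⟩ := (ht.bijective B.left).2 σ.1
    have hgp : g ≫ B.hom = p := by
      apply (ht.bijective S).1
      simp only at hp hg ⊢
      rw [hp, postcomp, eHomWhiskerLeft_comp, NatTrans.comp_app, ConcreteCategory.comp_apply, hg]
      refine Eq.trans σ.2 ?_
      rfl
    exact ⟨Over.homMk g hgp, Subtype.ext hg⟩

instance preservesFiniteProducts_overMapFunctor [ModelCategory C] [IsSimplicialModelCategory C] {S A : C} (a : A ⟶ S) :
    PreservesFiniteProducts (overMapFunctor a) where
  preserves m := by
    suffices ∀ n : SimplexCategoryᵒᵖ, PreservesLimitsOfShape (Discrete (Fin m))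
        (overMapFunctor a ⋙ (evaluation SimplexCategoryᵒᵖ (Type v)).obj n) from
      preservesLimitsOfShape_of_evaluation
        (show Over S ⥤ SimplexCategoryᵒᵖ ⥤ Type v from overMapFunctor a) _ this
    intro n
    obtain ⟨T, t, ht⟩ := exists_bijective_overMap a n.unop
    let τ : coyoneda.obj (op T) ⟶
        overMapFunctor a ⋙ (evaluation SimplexCategoryᵒᵖ (Type v)).obj n :=
      { app B := ↾ fun f ↦ ((overMapFunctor a).map f).app n t
        naturality B B' g := by
          ext f
          exact ConcreteCategory.congr_hom (NatTrans.congr_app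
            ((overMapFunctor a).map_comp f g) n) t }
    have hτ (B : Over S) : IsIso (τ.app B) := (isIso_iff_bijective _).2 (ht B)
    have : IsIso τ := NatIso.isIso_of_isIso_app τ
    exact preservesLimitsOfShape_of_natIso (asIso τ)

/-- The functor `B ↦ map_{C/S}(A, B)` is compatible with finite products, hence takes abelian group
objects over `S` to simplicial abelian groups. -/
instance braidedOverMapFunctor [ModelCategory C] [IsSimplicialModelCategory C] {S A : C} (a : A ⟶ S) :
    (overMapFunctor a).Braided :=
  .ofChosenFiniteProducts _

/-- The simplicial group `map_{C/S}(A, B)`, for a group object `B` over `S`. -/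
instance grpObjOverMap [ModelCategory C] [IsSimplicialModelCategory C] {S A B : C} (a : A ⟶ S) (b : B ⟶ S)
    [GrpObj (Over.mk b)] : GrpObj (C := SSet.{v}) (overMap a b) :=
  (overMapFunctor a).grpObjObj (G := Over.mk b)

instance isCommMonObj_overMap [ModelCategory C] [IsSimplicialModelCategory C] {S A B : C} (a : A ⟶ S) (b : B ⟶ S)
    [GrpObj (Over.mk b)] [IsCommMonObj (Over.mk b)] : IsCommMonObj (C := SSet.{v}) (overMap a b) :=
  (overMapFunctor a).isCommMonObj_obj (M := Over.mk b)

end Limits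

section Arrows

variable {C : Type u} [Category.{v} C] [SimplicialCategory C]

/-- The mapping space `map_{C(→)}(φ, ψ)` in the arrow category: pairs of a simplex `f` of
`map(X, W)` and a simplex `g` of `map(Y, Z)` such that `ψ ∘ f = g ∘ φ`. -/
def arrowMap {X Y W Z : C} (φ : X ⟶ Y) (ψ : W ⟶ Z) :
    (SimplicialCategory.sHom X W ⊗ SimplicialCategory.sHom Y Z).Subcomplex where
  obj n := {σ | (postcomp X ψ).app n σ.1 = (precomp φ Z).app n σ.2}
  map {n m} f σ hσ := by
    have h := congrArg ((SimplicialCategory.sHom X Z).map f) hσ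
    simp only [← NatTrans.naturality_apply] at h
    exact h

/-- The mapping space `map_{C(→)/ϑ}(φ, ψ)` over an arrow `ϑ : U ⟶ V`, where the structure maps of
`φ` and `ψ` are given by `x : X ⟶ U`, `y : Y ⟶ V` and `w : W ⟶ U`, `z : Z ⟶ V`: the pairs `(f, g)`
in `map_{C(→)}(φ, ψ)` such that `f` is over `U` and `g` is over `V`. -/
def arrowOverMap {U V X Y W Z : C} (x : X ⟶ U) (y : Y ⟶ V) (w : W ⟶ U) (z : Z ⟶ V)
    (φ : X ⟶ Y) (ψ : W ⟶ Z) :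
    (SimplicialCategory.sHom X W ⊗ SimplicialCategory.sHom Y Z).Subcomplex :=
  arrowMap φ ψ ⊓ (overMap x w).prod (overMap y z)

/-- The inclusion `map_{C(→)/ϑ}(φ, ψ) ⟶ map_{C/U}(X, W) × map_{C/V}(Y, Z)`. -/
def arrowOverMapIncl {U V X Y W Z : C} (x : X ⟶ U) (y : Y ⟶ V) (w : W ⟶ U) (z : Z ⟶ V)
    (φ : X ⟶ Y) (ψ : W ⟶ Z) :
    (arrowOverMap x y w z φ ψ : SSet.{v}) ⟶ (overMap x w : SSet.{v}) ⊗ (overMap y z : SSet.{v}) :=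
  CartesianMonoidalCategory.lift
    (SSet.Subcomplex.lift ((arrowOverMap x y w z φ ψ).ι ≫ fst _ _)
      (by rintro n _ ⟨σ, rfl⟩; exact σ.2.2.1))
    (SSet.Subcomplex.lift ((arrowOverMap x y w z φ ψ).ι ≫ snd _ _)
      (by rintro n _ ⟨σ, rfl⟩; exact σ.2.2.2))

/-- The difference map `ξ : map_{C/U}(X, W) × map_{C/V}(Y, Z) ⟶ map_{C/V}(X, Z)`,
`(f, g) ↦ ψ ∘ f - g ∘ φ`, where `X` is an object over `V` through `ϑ`. The group structure
of `map_{C/V}(X, Z)` that is induced by the one of `Z` is written multiplicatively. -/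
def diffMap [ModelCategory C] [IsSimplicialModelCategory C] {U V X Y W Z : C} (ϑ : U ⟶ V)
    (x : X ⟶ U) (y : Y ⟶ V) (w : W ⟶ U) (z : Z ⟶ V) (φ : X ⟶ Y) (ψ : W ⟶ Z)
    (hφ : φ ≫ y = x ≫ ϑ) (hψ : ψ ≫ z = w ≫ ϑ) [GrpObj (Over.mk z)] :
    (overMap x w : SSet.{v}) ⊗ (overMap y z : SSet.{v}) ⟶ (overMap (x ≫ ϑ) z : SSet.{v}) :=
  (fst _ _ ≫ overPostcomp x w (x ≫ ϑ) z ϑ ψ rfl hψ) / (snd _ _ ≫ overPrecomp (x ≫ ϑ) y z φ hφ)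

end Arrows

/-- `ψ : W ⟶ Z` over `ϑ : U ⟶ V` is a homomorphism from a group object over `U` to a group object
over `V`: `ψ (a b) = ψ a ψ b` on `W ×_U W`. -/
def IsHomOver {C : Type u} [Category.{v} C] [HasPullbacks C] {U V W Z : C} (ϑ : U ⟶ V)
    (w : W ⟶ U) (z : Z ⟶ V) (ψ : W ⟶ Z) (hψ : ψ ≫ z = w ≫ ϑ)
    [GrpObj (Over.mk w)] [GrpObj (Over.mk z)] : Prop :=
  let Ψ : (Over.map ϑ).obj (Over.mk w) ⟶ Over.mk z := Over.homMk ψ hψ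
  (Over.map ϑ).map μ[Over.mk w] ≫ Ψ =
    CartesianMonoidalCategory.lift ((Over.map ϑ).map (fst (Over.mk w) (Over.mk w)) ≫ Ψ)
      ((Over.map ϑ).map (snd (Over.mk w) (Over.mk w)) ≫ Ψ) ≫ μ[Over.mk z]

/-- A fibration sequence `F ⟶ E ⟶ B` of simplicial sets with basepoint `b` of `B`: a Kan fibration
`p : E ⟶ B` between Kan complexes, together with its fibre `i : F ⟶ E` over `b`. -/
structure IsFibrationSequence {F E B : SSet.{v}} (i : F ⟶ E) (p : E ⟶ B) (b : 𝟙_ SSet.{v} ⟶ B) :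
    Prop where
  kanComplex_total : SSet.KanComplex E
  kanComplex_base : SSet.KanComplex B
  fibration : Fibration p
  isPullback : IsPullback i (toUnit F) p b

end

end SimplicialMapping

/-! The functor `overMapFunctor` preserves finite products, so mapping spaces into group objects are
simplicial groups, hence Kan complexes by Moore's theorem (`kanComplex_of_grpObj`). This needs no
fibrancy of `w`.

To lift against `ξ` over a simplex `b`, first choose `f` in the Kan complex `map_{C/U}(X, W)`. The
equation `ξ(f, g) = b` then becomes `g ∘ φ = b⁻¹ (ψ ∘ f)` in multiplicative notation, a lifting
problem against restriction along `φ`. That restriction is a Kan fibration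
(`fibration_overPrecomp`), being a base change of the map in Quillen's axiom for `φ` and `z`.

The fibre of `ξ` over the unit consists of the pairs with `ψ ∘ f = g ∘ φ`. If `ψ` is a homomorphism,
then `ξ` is a quotient of two homomorphisms into a commutative group, hence a homomorphism, and its
kernel is a commutative group. -/

namespace SSet

/-! ### Moore's theorem on horn filling in simplicial groups. -/

section SimplicialGroup

variable {G : SSet.{v}} [GrpObj G] {n : ℕ}

/-- The correction term `(d_r g)⁻¹ f_r` has trivial `j`-th face if `g` has the prescribed
`j`-th face, for `j < r`. -/
lemma horn.IsCompatible.δ_castPred_inv_mul_eq_one {k : Fin (n + 3)}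
    {f : ∀ (j : Fin (n + 3)) (_ : j ≠ k), Δ[n + 1] ⟶ G} (hf : horn.IsCompatible f)
    (g : Δ[n + 2] ⟶ G) {j r : Fin (n + 3)} (hj : j ≠ k) (hr : r ≠ k) (hjr : j < r)
    (hg : stdSimplex.δ j ≫ g = f j hj) :
    stdSimplex.δ (j.castPred (Fin.ne_last_of_lt hjr)) ≫
      ((stdSimplex.δ r ≫ g)⁻¹ * f r hr) = 1 := by
  -- Horn compatibility gives `d_j f_r = d_{r-1} f_j = d_{r-1} d_j g`, and the simplicial identity
  -- turns this into `d_j d_r g`.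
  rw [MonObj.comp_mul, GrpObj.comp_inv, inv_mul_eq_one, ← hf.δ_pred_comp j r hj hr hjr, ← hg,
    ← assoc, ← assoc]
  obtain ⟨j, rfl⟩ := j.eq_castSucc_of_ne_last (Fin.ne_last_of_lt hjr)
  obtain ⟨r, rfl⟩ := r.eq_succ_of_ne_zero (Fin.ne_zero_of_lt hjr)
  rw [Fin.pred_succ, Fin.castPred_castSucc, stdSimplex.δ_comp_δ (by grind)]

/-- The correction term `(d_r g)⁻¹ f_r` has trivial face opposite to `j` if `g` has the prescribed
`j`-th face, for `r < j`. -/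
lemma horn.IsCompatible.δ_pred_inv_mul_eq_one {k : Fin (n + 3)}
    {f : ∀ (j : Fin (n + 3)) (_ : j ≠ k), Δ[n + 1] ⟶ G} (hf : horn.IsCompatible f)
    (g : Δ[n + 2] ⟶ G) {j r : Fin (n + 3)} (hj : j ≠ k) (hr : r ≠ k) (hrj : r < j)
    (hg : stdSimplex.δ j ≫ g = f j hj) :
    stdSimplex.δ (j.pred (Fin.ne_zero_of_lt hrj)) ≫
      ((stdSimplex.δ r ≫ g)⁻¹ * f r hr) = 1 := by
  rw [MonObj.comp_mul, GrpObj.comp_inv, inv_mul_eq_one, hf.δ_pred_comp r j hr hj hrj, ← hg,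
    ← assoc, ← assoc]
  obtain ⟨r, rfl⟩ := r.eq_castSucc_of_ne_last (Fin.ne_last_of_lt hrj)
  obtain ⟨j, rfl⟩ := j.eq_succ_of_ne_zero (Fin.ne_zero_of_lt hrj)
  rw [Fin.pred_succ, Fin.castPred_castSucc, stdSimplex.δ_comp_δ (by grind)]

/-- Multiplying by a degeneracy `s_r` of the correction term does not change the `j`-th face
for `j < r`. -/
lemma horn.IsCompatible.δ_mul_σ_of_lt {k : Fin (n + 2)}
    {f : ∀ (j : Fin (n + 2)) (_ : j ≠ k), Δ[n] ⟶ G} (hf : horn.IsCompatible f)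
    (g : Δ[n + 1] ⟶ G) {j r : Fin (n + 2)} {s : Fin (n + 1)} (hj : j ≠ k) (hr : r ≠ k)
    (hjr : j < r) (hjs : j < s.castSucc)
    (hg : stdSimplex.δ j ≫ g = f j hj) :
    stdSimplex.δ j ≫ (g * stdSimplex.σ s ≫ ((stdSimplex.δ r ≫ g)⁻¹ * f r hr)) = f j hj := by
  obtain _ | n := n
  · grind
  have h := hf.δ_castPred_inv_mul_eq_one g hj hr hjr hg
  obtain ⟨j, rfl⟩ := j.eq_castSucc_of_ne_last (Fin.ne_last_of_lt hjs)
  obtain ⟨s, rfl⟩ := s.eq_succ_of_ne_zero (by grind)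
  rw [Fin.castPred_castSucc] at h
  rw [MonObj.comp_mul, stdSimplex.δ_comp_σ_of_le_assoc (by grind), h, MonObj.comp_one, mul_one, hg]

/-- Multiplying by a degeneracy `s_s` of the correction term does not change the `j`-th face
for `j > s + 1`. -/
lemma horn.IsCompatible.δ_mul_σ_of_gt {k : Fin (n + 2)}
    {f : ∀ (j : Fin (n + 2)) (_ : j ≠ k), Δ[n] ⟶ G} (hf : horn.IsCompatible f)
    (g : Δ[n + 1] ⟶ G) {j r : Fin (n + 2)} {s : Fin (n + 1)} (hj : j ≠ k) (hr : r ≠ k)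
    (hrj : r < j) (hsj : s.succ < j)
    (hg : stdSimplex.δ j ≫ g = f j hj) :
    stdSimplex.δ j ≫ (g * stdSimplex.σ s ≫ ((stdSimplex.δ r ≫ g)⁻¹ * f r hr)) = f j hj := by
  obtain _ | n := n
  · grind
  have h := hf.δ_pred_inv_mul_eq_one g hj hr hrj hg
  obtain ⟨j, rfl⟩ := j.eq_succ_of_ne_zero (Fin.ne_zero_of_lt hrj)
  obtain ⟨s, rfl⟩ := s.eq_castSucc_of_ne_last (by grind)
  rw [Fin.pred_succ] at h
  rw [MonObj.comp_mul, stdSimplex.δ_comp_σ_of_gt_assoc (by grind), h, MonObj.comp_one, mul_one, hg]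

/-- The faces below `k` are corrected in increasing order, starting from the unit simplex. Since
`d_m s_m = id`, multiplying by `s_m((d_m g)⁻¹ f_m)` repairs face `m`, and it preserves the earlier
faces. -/
lemma horn.IsCompatible.exists_lift_of_grpObj_of_lt {k : Fin (n + 2)}
    {f : ∀ (j : Fin (n + 2)) (_ : j ≠ k), Δ[n] ⟶ G} (hf : horn.IsCompatible f)
    (m : ℕ) (hm : m ≤ k) :
    ∃ g : Δ[n + 1] ⟶ G, ∀ (j : Fin (n + 2)) (hj : j ≠ k), j < m → stdSimplex.δ j ≫ g = f j hj := by
  induction m with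
  | zero => exact ⟨1, by simp⟩
  | succ m ih =>
    obtain ⟨g, hg⟩ := ih (by lia)
    let s : Fin (n + 1) := ⟨m, by lia⟩
    have hr : s.castSucc ≠ k := by grind
    refine ⟨g * stdSimplex.σ s ≫ ((stdSimplex.δ s.castSucc ≫ g)⁻¹ * f s.castSucc hr),
      fun j hj hjm ↦ ?_⟩
    obtain hjm | rfl : j.val < m ∨ j = s.castSucc := by grind
    · exact hf.δ_mul_σ_of_lt g hj hr (by grind) (by grind) (hg j hj hjm)
    · rw [MonObj.comp_mul, stdSimplex.δ_comp_σ_self_assoc, mul_inv_cancel_left]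

/-- The faces above `k` are then corrected in decreasing order; `m` counts those already done. Face
`r` is repaired with `s_{r-1}`, using `d_r s_{r-1} = id`. The faces below `k` survive because the
missing index `k` forces `j < r - 1`. -/
lemma horn.IsCompatible.exists_lift_of_grpObj_of_lt_or_ge {k : Fin (n + 2)}
    {f : ∀ (j : Fin (n + 2)) (_ : j ≠ k), Δ[n] ⟶ G} (hf : horn.IsCompatible f)
    (m : ℕ) (hm : m + k ≤ n + 1) :
    ∃ g : Δ[n + 1] ⟶ G, ∀ (j : Fin (n + 2)) (hj : j ≠ k), j < k ∨ n + 2 ≤ j + m →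
      stdSimplex.δ j ≫ g = f j hj := by
  induction m with
  | zero =>
    obtain ⟨g, hg⟩ := hf.exists_lift_of_grpObj_of_lt k le_rfl
    exact ⟨g, fun j hj h ↦ hg j hj (by grind)⟩
  | succ m ih =>
    obtain ⟨g, hg⟩ := ih (by lia)
    let s : Fin (n + 1) := ⟨n - m, by lia⟩
    have hr : s.succ ≠ k := by grind
    refine ⟨g * stdSimplex.σ s ≫ ((stdSimplex.δ s.succ ≫ g)⁻¹ * f s.succ hr),
      fun j hj hjm ↦ ?_⟩
    obtain hjm | hjm | rfl : j < k ∨ s.succ < j ∨ j = s.succ := by grind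
    · exact hf.δ_mul_σ_of_lt g hj hr (by grind) (by grind) (hg j hj (by grind))
    · exact hf.δ_mul_σ_of_gt g hj hr hjm hjm (hg j hj (by grind))
    · rw [MonObj.comp_mul, stdSimplex.δ_comp_σ_succ_assoc, mul_inv_cancel_left]

/-- Moore's theorem: simplicial groups are Kan complexes. -/
lemma kanComplex_of_grpObj (G : SSet.{v}) [GrpObj G] : KanComplex G := by
  rw [KanComplex.iff]
  intro n k f hf
  -- There are `n + 1 - k` faces above `k`, so every face of the horn is now prescribed.
  obtain ⟨g, hg⟩ := hf.exists_lift_of_grpObj_of_lt_or_ge (n + 1 - k) (by lia)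
  exact ⟨g, fun j hj ↦ hg j hj (by grind)⟩

end SimplicialGroup

/-! ### Kan fibrations and Kan complexes built from products and quotients. -/

section Fibrations

/-- If `E` is a Kan complex, `q : E' ⟶ B` is a Kan fibration and `B` is a simplicial group, then
`(e, e') ↦ p e / q e'` is a Kan fibration. -/
lemma fibration_fst_comp_div_snd_comp {E E' B : SSet.{v}} [GrpObj B] [KanComplex E]
    (p : E ⟶ B) (q : E' ⟶ B) [hq : Fibration q] :
    Fibration ((fst E E' ≫ p) / (snd E E' ≫ q)) := by
  rw [modelCategoryQuillen.fibration_iff] at hq ⊢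
  intro A A' i hi
  have hE := (isFibrant_iff E).1 inferInstance
  rw [modelCategoryQuillen.fibration_iff] at hE
  have := hE i hi
  have := hq i hi
  refine ⟨fun {t b} sq ↦ ?_⟩
  have sqE : CommSq (t ≫ fst E E') i (terminal.from E) (terminal.from A') := ⟨by simp⟩
  -- Solving `p e / q e' = b` for `q e'`; the order of the factors matters, as `B` need not be
  -- commutative.
  have sqE' : CommSq (t ≫ snd E E') i q (b⁻¹ * (sqE.lift ≫ p)) := ⟨by
    have h := sq.w
    rw [GrpObj.comp_div] at h
    rw [MonObj.comp_mul, GrpObj.comp_inv, ← h, sqE.fac_left_assoc]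
    simp⟩
  exact ⟨⟨{
    l := lift sqE.lift sqE'.lift
    fac_left := by ext1 <;> simp
    fac_right := by
      rw [GrpObj.comp_div, lift_fst_assoc, lift_snd_assoc, sqE'.fac_right]
      simp }⟩⟩

lemma kanComplex_tensor (E E' : SSet.{v}) [KanComplex E] [KanComplex E'] :
    KanComplex (E ⊗ E') := by
  refine (isFibrant_iff _).2 ((modelCategoryQuillen.fibration_iff _).2 ?_)
  intro A A' i hi
  have hE := (isFibrant_iff E).1 inferInstance
  have hE' := (isFibrant_iff E').1 inferInstance
  rw [modelCategoryQuillen.fibration_iff] at hE hE'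
  have := hE i hi
  have := hE' i hi
  refine ⟨fun {t b} sq ↦ ?_⟩
  have sqE : CommSq (t ≫ fst E E') i (terminal.from E) (terminal.from A') := ⟨by simp⟩
  have sqE' : CommSq (t ≫ snd E E') i (terminal.from E') (terminal.from A') := ⟨by simp⟩
  exact ⟨⟨{
    l := lift sqE.lift sqE'.lift
    fac_left := by ext1 <;> simp
    fac_right := by subsingleton }⟩⟩

end Fibrations

end SSet

/-! ### Homomorphisms and kernels of group objects. -/

namespace CategoryTheory

variable {D : Type u} [Category.{v} D] [CartesianMonoidalCategory D]

/-- A morphism between group objects which is compatible with the multiplications is a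
homomorphism. -/
lemma IsMonHom.of_mul_hom_of_grpObj {G H : D} [GrpObj G] [GrpObj H] (f : G ⟶ H)
    (h : μ[G] ≫ f = (f ⊗ₘ f) ≫ μ[H]) : IsMonHom f where
  one_hom := by
    -- The image of the unit is idempotent, and an idempotent in a group is trivial.
    have h1 : (η[G] ≫ f) * (η[G] ≫ f) = η[G] ≫ f := by
      have h2 := congr(lift η[G] η[G] ≫ $h)
      rw [lift_map_assoc, ← Hom.mul_def, ← assoc, ← Hom.mul_def, MonObj.one_eq_one, one_mul] at h2
      rw [MonObj.one_eq_one]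
      exact h2.symm
    rw [mul_eq_left.1 h1, MonObj.one_eq_one]
  mul_hom := h

/-- The quotient of two homomorphisms into a commutative group object is a homomorphism. -/
lemma isMonHom_div [BraidedCategory D] {M G : D} [MonObj M] [GrpObj G] [IsCommMonObj G]
    (f g : M ⟶ G) [IsMonHom f] [IsMonHom g] : IsMonHom (f / g) := by
  rw [div_eq_mul_inv]
  exact inferInstanceAs (IsMonHom (lift f g⁻¹ ≫ μ[G]))

/-- The kernel of a homomorphism from a commutative group object is a commutative group object. -/
lemma exists_grpObj_of_isPullback_η [BraidedCategory D] {K G H : D}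
    [GrpObj G] [IsCommMonObj G] [GrpObj H]
    {i : K ⟶ G} {f : G ⟶ H} [IsMonHom f] (h : IsPullback i (toUnit K) f η[H]) :
    ∃ (_ : GrpObj K), IsCommMonObj K ∧ IsMonHom i := by
  have hi : Mono i := h.mono_fst_of_mono
  have hw : i ≫ f = 1 := h.w
  have h1 (T : D) : (1 : T ⟶ H) = toUnit T ≫ η := rfl
  -- The operations of `G` restrict to `K` by the universal property of the kernel; the axioms can
  -- then be checked after the monomorphism `i`.
  let mul : K ⊗ K ⟶ K := h.lift ((fst K K ≫ i) * (snd K K ≫ i)) (toUnit _) (by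
    rw [MonObj.mul_comp, assoc, assoc, hw, MonObj.comp_one, MonObj.comp_one, one_mul, h1])
  let one : 𝟙_ D ⟶ K := h.lift 1 (toUnit _) (by rw [MonObj.one_comp, h1])
  let inv : K ⟶ K := h.lift i⁻¹ (toUnit _) (by rw [GrpObj.inv_comp, hw, inv_one, h1])
  have hmul : mul ≫ i = (fst K K ≫ i) * (snd K K ≫ i) := h.lift_fst _ _ _
  have hone : one ≫ i = 1 := h.lift_fst _ _ _
  have hinv : inv ≫ i = i⁻¹ := h.lift_fst _ _ _
  let inst : GrpObj K :=
    { one := one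
      mul := mul
      inv := inv
      one_mul := by
        rw [← cancel_mono i]
        simp [hmul, hone, MonObj.comp_mul, MonObj.comp_one, leftUnitor_hom]
      mul_one := by
        rw [← cancel_mono i]
        simp [hmul, hone, MonObj.comp_mul, MonObj.comp_one, rightUnitor_hom]
      mul_assoc := by
        rw [← cancel_mono i]
        simp [hmul, MonObj.comp_mul, mul_assoc]
      left_inv := by
        rw [← cancel_mono i]
        simp [hmul, hone, hinv, MonObj.comp_mul, MonObj.comp_one]
      right_inv := by
        rw [← cancel_mono i]
        simp [hmul, hone, hinv, MonObj.comp_mul, MonObj.comp_one] }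
  refine ⟨inst, ⟨?_⟩, ⟨?_, ?_⟩⟩
  · change (β_ K K).hom ≫ mul = mul
    rw [← cancel_mono i]
    simp [hmul, MonObj.comp_mul, mul_comm]
  · exact hone.trans (MonObj.one_eq_one (M := G)).symm
  · change mul ≫ i = _
    rw [hmul, MonObj.mul_eq_mul, MonObj.comp_mul]
    simp

end CategoryTheory

namespace SimplicialMapping

noncomputable section

/-! ### Functoriality of mapping spaces over a base, and restriction along cofibrations. -/

section OverMap

variable {C : Type u} [Category.{v} C] [SimplicialCategory C]

@[simp]
lemma overPostcomp_ι {S S' A B B' : C} (a : A ⟶ S) (b : B ⟶ S) (a' : A ⟶ S') (b' : B' ⟶ S')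
    (s : S ⟶ S') (g : B ⟶ B') (ha : a ≫ s = a') (hg : g ≫ b' = b ≫ s) :
    overPostcomp a b a' b' s g ha hg ≫ (overMap a' b').ι = (overMap a b).ι ≫ postcomp A g :=
  SSet.Subcomplex.lift_ι _ _

@[simp]
lemma overPrecomp_ι {S A A' B : C} (a : A ⟶ S) (a' : A' ⟶ S) (b : B ⟶ S)
    (f : A ⟶ A') (hf : f ≫ a' = a) :
    overPrecomp a a' b f hf ≫ (overMap a b).ι = (overMap a' b).ι ≫ precomp f B :=
  SSet.Subcomplex.lift_ι _ _

/-- The two intermediate bases are independent because, in `isMonHom_overPostcomp`, one path changes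
base from `U` to `V` last and the other first. -/
lemma overPostcomp_comp_overPostcomp_eq {S S₁ S₂ S' A B B₁ B₂ B' : C}
    {a : A ⟶ S} {b : B ⟶ S} {a₁ : A ⟶ S₁} {b₁ : B₁ ⟶ S₁} {a₂ : A ⟶ S₂} {b₂ : B₂ ⟶ S₂}
    {a' : A ⟶ S'} {b' : B' ⟶ S'} {s₁ : S ⟶ S₁} {s₂ : S ⟶ S₂} {s₁' : S₁ ⟶ S'} {s₂' : S₂ ⟶ S'}
    {g₁ : B ⟶ B₁} {g₂ : B ⟶ B₂} {g₁' : B₁ ⟶ B'} {g₂' : B₂ ⟶ B'}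
    (ha₁ : a ≫ s₁ = a₁) (hg₁ : g₁ ≫ b₁ = b ≫ s₁) (ha₁' : a₁ ≫ s₁' = a') (hg₁' : g₁' ≫ b' = b₁ ≫ s₁')
    (ha₂ : a ≫ s₂ = a₂) (hg₂ : g₂ ≫ b₂ = b ≫ s₂) (ha₂' : a₂ ≫ s₂' = a') (hg₂' : g₂' ≫ b' = b₂ ≫ s₂')
    (h : g₁ ≫ g₁' = g₂ ≫ g₂') :
    overPostcomp a b a₁ b₁ s₁ g₁ ha₁ hg₁ ≫ overPostcomp a₁ b₁ a' b' s₁' g₁' ha₁' hg₁' =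
      overPostcomp a b a₂ b₂ s₂ g₂ ha₂ hg₂ ≫ overPostcomp a₂ b₂ a' b' s₂' g₂' ha₂' hg₂' := by
  rw [← cancel_mono (overMap a' b').ι]
  simp only [assoc, overPostcomp_ι]
  simp only [← assoc, overPostcomp_ι]
  simp only [assoc, ← eHomWhiskerLeft_comp, h]

/-- The comparison map `map(A', B) ⟶ map(A, B) ×_{map(A, S)} map(A', S)` is a Kan fibration if
`f : A ⟶ A'` is a cofibration and `b : B ⟶ S` is a fibration. -/
lemma exists_isPullback_fibration [ModelCategory C] [IsSimplicialModelCategory C] {A A' B S : C}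
    (f : A ⟶ A') (b : B ⟶ S) [Cofibration f] [Fibration b] :
    ∃ (P : SSet.{v}) (p₁ : P ⟶ SimplicialCategory.sHom A B)
      (p₂ : P ⟶ SimplicialCategory.sHom A' S) (π : SimplicialCategory.sHom A' B ⟶ P),
      IsPullback p₁ p₂ (postcomp A b) (precomp f S) ∧ π ≫ p₁ = precomp f B ∧
        π ≫ p₂ = postcomp A' b ∧ Fibration π :=
  let sq := Functor.PullbackObjObj.ofHasPullback (SimplicialCategory.sHomFunctor C) f b
  ⟨sq.pt, sq.fst, sq.snd, sq.π, sq.isPullback, sq.π_fst, sq.π_snd,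
    IsSimplicialModelCategory.fibration_π f b sq⟩

/-- Restriction along a cofibration is a Kan fibration on mapping spaces over `S` into
a fibration. -/
lemma fibration_overPrecomp [ModelCategory C] [IsSimplicialModelCategory C] {S A A' B : C}
    (a : A ⟶ S) (a' : A' ⟶ S) (b : B ⟶ S) (f : A ⟶ A') (hf : f ≫ a' = a)
    [Cofibration f] [Fibration b] : Fibration (overPrecomp a a' b f hf) := by
  obtain ⟨P, p₁, p₂, π, hP, hπ₁, hπ₂, hπ⟩ := exists_isPullback_fibration f b
  rw [SSet.modelCategoryQuillen.fibration_iff] at hπ ⊢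
  intro K L i hi
  have := hπ i hi
  refine ⟨fun {t d} h ↦ ?_⟩
  -- Taking the constant map at `a'` as second component forces any lift through `π` to lie over
  -- `S`, that is, in `overMap a' b`.
  let e : L ⟶ P := hP.lift (d ≫ (overMap a b).ι) (constMap L a') (by
    rw [assoc, overMap_ι_postcomp, comp_constMap, constMap_precomp, hf])
  have he₁ : e ≫ p₁ = d ≫ (overMap a b).ι := hP.lift_fst _ _ _
  have he₂ : e ≫ p₂ = constMap L a' := hP.lift_snd _ _ _
  have hsq : CommSq (t ≫ (overMap a' b).ι) i π e := ⟨by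
    apply hP.hom_ext
    · rw [assoc, assoc, hπ₁, assoc, he₁, ← reassoc_of% h.w, overPrecomp_ι]
    · rw [assoc, assoc, hπ₂, assoc, he₂, comp_constMap, overMap_ι_postcomp, comp_constMap]⟩
  have hl : hsq.lift ≫ postcomp A' b = constMap L a' := by
    rw [← hπ₂, hsq.fac_right_assoc, he₂]
  have hl' : hsq.lift ≫ precomp f B = d ≫ (overMap a b).ι := by
    rw [← hπ₁, hsq.fac_right_assoc, he₁]
  let l : L ⟶ overMap a' b := SSet.Subcomplex.lift hsq.lift (le_overMap _ _ _ hl)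
  have hlι : l ≫ (overMap a' b).ι = hsq.lift := SSet.Subcomplex.lift_ι _ _
  exact ⟨⟨{
    l := l
    fac_left := by rw [← cancel_mono (overMap a' b).ι, assoc, hlι, hsq.fac_left]
    fac_right := by rw [← cancel_mono (overMap a b).ι, assoc, overPrecomp_ι, ← assoc, hlι, hl'] }⟩⟩

/-- Restriction along `f`, as a natural transformation. -/
def overPrecompNatTrans {S A A' : C} (a : A ⟶ S) (a' : A' ⟶ S) (f : A ⟶ A') (hf : f ≫ a' = a) :
    overMapFunctor a' ⟶ overMapFunctor a where
  app B := overPrecomp a a' B.hom f hf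
  naturality B B' g := by
    change overPostcomp a' B.hom a' B'.hom (𝟙 S) g.left (by simp) (by simp) ≫
        overPrecomp a a' B'.hom f hf =
      overPrecomp a a' B.hom f hf ≫ overPostcomp a B.hom a B'.hom (𝟙 S) g.left (by simp) (by simp)
    rw [← cancel_mono (overMap a B'.hom).ι]
    rw [assoc, assoc, overPrecomp_ι, overPostcomp_ι, ← assoc, ← assoc, overPostcomp_ι,
      overPrecomp_ι, assoc, assoc, eHom_whisker_exchange]

end OverMap

/-! ### Restriction and composition as group homomorphisms. -/

section Homomorphisms

variable {C : Type u} [Category.{v} C] [SimplicialCategory C] [ModelCategory C]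
  [IsSimplicialModelCategory C]

/-- Restriction along `f` is a homomorphism on mapping spaces into a group object. -/
instance isMonHom_overPrecomp {S A A' B : C} (a : A ⟶ S) (a' : A' ⟶ S) (b : B ⟶ S)
    (f : A ⟶ A') (hf : f ≫ a' = a) [GrpObj (Over.mk b)] : IsMonHom (overPrecomp a a' b f hf) := by
  let α := overPrecompNatTrans a a' f hf
  refine .of_mul_hom_of_grpObj (D := SSet.{v}) _ ?_
  change (Functor.LaxMonoidal.μ (overMapFunctor a') (Over.mk b) (Over.mk b) ≫
    (overMapFunctor a').map μ[Over.mk b]) ≫ α.app (Over.mk b) =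
      (α.app (Over.mk b) ⊗ₘ α.app (Over.mk b)) ≫
        Functor.LaxMonoidal.μ (overMapFunctor a) (Over.mk b) (Over.mk b) ≫
          (overMapFunctor a).map μ[Over.mk b]
  -- A natural transformation between finite-product-preserving functors is automatically monoidal.
  rw [assoc, α.naturality, ← NatTrans.IsMonoidal.tensor_assoc]

/-- Composition with a homomorphism over `ϑ` is a homomorphism on mapping spaces. -/
lemma isMonHom_overPostcomp {U V X W Z : C} (ϑ : U ⟶ V) (x : X ⟶ U) (w : W ⟶ U) (z : Z ⟶ V)
    (ψ : W ⟶ Z) (hψ : ψ ≫ z = w ≫ ϑ) [GrpObj (Over.mk w)] [GrpObj (Over.mk z)]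
    (h : IsHomOver ϑ w z ψ hψ) : IsMonHom (overPostcomp x w (x ≫ ϑ) z ϑ ψ rfl hψ) := by
  let F := overMapFunctor x
  let F' := overMapFunctor (x ≫ ϑ)
  let Ψ : (Over.map ϑ).obj (Over.mk w) ⟶ Over.mk z := Over.homMk ψ hψ
  -- This is `ψ × ψ : W ×_U W ⟶ Z ×_V Z`. It must be built by hand, since `Over.map ϑ` need not
  -- preserve products.
  let Φ : (Over.map ϑ).obj (Over.mk w ⊗ Over.mk w) ⟶ Over.mk z ⊗ Over.mk z :=
    lift ((Over.map ϑ).map (fst _ _) ≫ Ψ) ((Over.map ϑ).map (snd _ _) ≫ Ψ)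
  let P : F.obj (Over.mk w) ⟶ F'.obj (Over.mk z) := overPostcomp x w (x ≫ ϑ) z ϑ ψ rfl hψ
  let Q : F.obj (Over.mk w ⊗ Over.mk w) ⟶ F'.obj (Over.mk z ⊗ Over.mk z) :=
    overPostcomp x (Over.mk w ⊗ Over.mk w).hom (x ≫ ϑ) (Over.mk z ⊗ Over.mk z).hom ϑ Φ.left rfl
      (Over.w Φ)
  have hPQ (p : Over.mk w ⊗ Over.mk w ⟶ Over.mk w) (q : Over.mk z ⊗ Over.mk z ⟶ Over.mk z)
      (hpq : (Over.map ϑ).map p ≫ Ψ = Φ ≫ q) : F.map p ≫ P = Q ≫ F'.map q :=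
    overPostcomp_comp_overPostcomp_eq (comp_id x) ((Over.w p).trans (comp_id _).symm) rfl hψ
      rfl (Over.w Φ) (comp_id _) ((Over.w q).trans (comp_id _).symm) congr(($hpq).left)
  -- Composition with `ψ × ψ` is `P ⊗ₘ P` under the product comparisons, as is seen on the two
  -- projections.
  have hQ : Functor.LaxMonoidal.μ F _ _ ≫ Q = (P ⊗ₘ P) ≫ Functor.LaxMonoidal.μ F' _ _ := by
    rw [← cancel_mono (Functor.OplaxMonoidal.δ F' _ _), assoc, assoc,
      Functor.Monoidal.μ_δ, comp_id]
    ext1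
    · rw [assoc, assoc, Functor.OplaxMonoidal.δ_fst, ← hPQ (fst _ _) (fst _ _) (by simp [Φ]),
        Functor.Monoidal.μ_fst_assoc, tensorHom_fst]
    · rw [assoc, assoc, Functor.OplaxMonoidal.δ_snd, ← hPQ (snd _ _) (snd _ _) (by simp [Φ]),
        Functor.Monoidal.μ_snd_assoc, tensorHom_snd]
  refine .of_mul_hom_of_grpObj (D := SSet.{v}) _ ?_
  change (Functor.LaxMonoidal.μ F _ _ ≫ F.map μ[Over.mk w]) ≫ P =
      (P ⊗ₘ P) ≫ Functor.LaxMonoidal.μ F' _ _ ≫ F'.map μ[Over.mk z]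
  rw [assoc, hPQ _ _ h, reassoc_of% hQ]

end Homomorphisms

/-! ### The arrow mapping space as the fibre of the difference map. -/

section Arrows

variable {C : Type u} [Category.{v} C] [SimplicialCategory C]
  {U V X Y W Z : C} (x : X ⟶ U) (y : Y ⟶ V) (w : W ⟶ U) (z : Z ⟶ V) (φ : X ⟶ Y) (ψ : W ⟶ Z)

lemma arrowOverMapIncl_tensor_ι :
    arrowOverMapIncl x y w z φ ψ ≫ ((overMap x w).ι ⊗ₘ (overMap y z).ι) =
      (arrowOverMap x y w z φ ψ).ι := rfl

instance mono_overMap_ι_tensor :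
    Mono ((overMap x w).ι ⊗ₘ (overMap y z).ι) where
  right_cancellation f g h := by
    have h₁ := congr($h ≫ fst _ _)
    have h₂ := congr($h ≫ snd _ _)
    simp only [assoc, tensorHom_fst, tensorHom_snd] at h₁ h₂
    ext1
    · rwa [← cancel_mono (overMap x w).ι, assoc, assoc]
    · rwa [← cancel_mono (overMap y z).ι, assoc, assoc]

/-- `map_{C(→)/ϑ}(φ, ψ)` is the kernel of the difference map. -/
lemma isPullback_arrowOverMapIncl [ModelCategory C] [IsSimplicialModelCategory C] (ϑ : U ⟶ V)
    (hφ : φ ≫ y = x ≫ ϑ) (hψ : ψ ≫ z = w ≫ ϑ) [GrpObj (Over.mk z)] :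
    IsPullback (arrowOverMapIncl x y w z φ ψ) (toUnit _) (diffMap ϑ x y w z φ ψ hφ hψ)
      η[(overMap (x ≫ ϑ) z : SSet.{v})] := by
  -- A quotient is trivial exactly when its two terms agree, and agreement can be tested in the full
  -- mapping space `map(X, Z)`.
  have key {K : SSet.{v}} (k : K ⟶ (overMap x w : SSet.{v}) ⊗ (overMap y z : SSet.{v})) :
      k ≫ diffMap ϑ x y w z φ ψ hφ hψ = toUnit K ≫ η ↔
        k ≫ fst _ _ ≫ (overMap x w).ι ≫ postcomp X ψ =
          k ≫ snd _ _ ≫ (overMap y z).ι ≫ precomp φ Z := by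
    change _ = (1 : K ⟶ _) ↔ _
    rw [diffMap, GrpObj.comp_div, div_eq_one, ← cancel_mono (overMap (x ≫ ϑ) z).ι]
    simp only [assoc, overPostcomp_ι, overPrecomp_ι]
  refine ⟨⟨(key _).2 ?_⟩, ⟨PullbackCone.IsLimit.mk _ (fun s ↦ SSet.Subcomplex.lift
    (s.fst ≫ ((overMap x w).ι ⊗ₘ (overMap y z).ι)) ?_) (fun s ↦ ?_) (fun s ↦ toUnit_unique _ _)
    (fun s m hm _ ↦ ?_)⟩⟩
  · ext n σ
    exact σ.2.1
  · rintro n _ ⟨σ, rfl⟩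
    refine ⟨?_, (s.fst.app n σ).1.2, (s.fst.app n σ).2.2⟩
    have h := (key s.fst).1 (s.condition.trans (by rw [toUnit_unique s.snd (toUnit _)]))
    exact ConcreteCategory.congr_hom (NatTrans.congr_app h n) σ
  · rw [← cancel_mono ((overMap x w).ι ⊗ₘ (overMap y z).ι), assoc, arrowOverMapIncl_tensor_ι]
    exact SSet.Subcomplex.lift_ι _ _
  · rw [← cancel_mono (arrowOverMap x y w z φ ψ).ι, ← arrowOverMapIncl_tensor_ι, reassoc_of% hm]
    exact (SSet.Subcomplex.lift_ι _ _).symm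

end Arrows

end

end SimplicialMapping

theorem proposition5p8 {C : Type u} [Category.{v} C] [ModelCategory C] [SimplicialCategory C]
    [SimplicialMapping.IsSimplicialModelCategory C]
    {U V X Y W Z : C} (ϑ : U ⟶ V)
    (x : X ⟶ U) (y : Y ⟶ V) (w : W ⟶ U) (z : Z ⟶ V) (φ : X ⟶ Y) (ψ : W ⟶ Z)
    (hφ : φ ≫ y = x ≫ ϑ) (hψ : ψ ≫ z = w ≫ ϑ)
    [Cofibration φ] [IsCofibrant X] [Fibration z]
    [GrpObj (Over.mk w)] [IsCommMonObj (Over.mk w)]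
    [GrpObj (Over.mk z)] [IsCommMonObj (Over.mk z)] :
    SimplicialMapping.IsFibrationSequence
      (SimplicialMapping.arrowOverMapIncl x y w z φ ψ)
      (SimplicialMapping.diffMap ϑ x y w z φ ψ hφ hψ)
      η[(SimplicialMapping.overMap (x ≫ ϑ) z : SSet.{v})] ∧
    (SimplicialMapping.IsHomOver ϑ w z ψ hψ →
      IsMonHom (SimplicialMapping.diffMap ϑ x y w z φ ψ hφ hψ) ∧
      ∃ (_ : GrpObj (C := SSet.{v}) (SimplicialMapping.arrowOverMap x y w z φ ψ)),
        IsCommMonObj (C := SSet.{v}) (SimplicialMapping.arrowOverMap x y w z φ ψ) ∧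
        IsMonHom (SimplicialMapping.arrowOverMapIncl x y w z φ ψ)) := by
  have := SSet.kanComplex_of_grpObj (SimplicialMapping.overMap x w)
  have := SSet.kanComplex_of_grpObj (SimplicialMapping.overMap y z)
  have := SimplicialMapping.fibration_overPrecomp (x ≫ ϑ) y z φ hφ
  have hpb := SimplicialMapping.isPullback_arrowOverMapIncl x y w z φ ψ ϑ hφ hψ
  refine ⟨⟨SSet.kanComplex_tensor _ _, SSet.kanComplex_of_grpObj _,
    -- Only the second term, restriction along `φ`, has to be a fibration; for the first it suffices
    -- that its source is Kan.
    SSet.fibration_fst_comp_div_snd_comp _ _, hpb⟩, fun h ↦ ?_⟩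
  have := SimplicialMapping.isMonHom_overPostcomp ϑ x w z ψ hψ h
  have hd : IsMonHom (SimplicialMapping.diffMap ϑ x y w z φ ψ hφ hψ) :=
    isMonHom_div (D := SSet.{v}) _ _
  exact ⟨hd, exists_grpObj_of_isPullback_η hpb⟩
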